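/- Let $G$ be a group. A subset $S \subseteq G$ is called \emph{elementary algebraic} if there are an integer $n>0$, elements $a_1,\dots,a_n\in G$ and $\varepsilon_1,\dots,\varepsilon_n\in\{-1,1\}$ such that $$S=\{x\in G: x^{\varepsilon_1}a_1x^{\varepsilon_2}a_2\cdots a_{n-1}x^{\varepsilon_n}=a_n\},$$ \emph{algebraic} if it is an intersection of finite unions of elementary algebraic subsets of $G$ (the empty union $\emptyset$ and the empty intersection $G$ being allowed), and \emph{unconditionally closed} if it is closed in every Hausdorff group topology on $G$. The \emph{Zariski topology} $\mathfrak{Z}_G$ is the topology on $G$ whose closed sets are exactly the algebraic sets, and the \emph{Markov topology} $\mathfrak{M}_G$ is the topology on $G$ whose closed sets are exactly the unconditionally closed sets. For a subgroup $H$ of $G$, write $\mathfrak{Z}_G\upharpoonright_H$ and $\mathfrak{M}_G\upharpoonright_H$ for the subspace topologies that they induce on $H$; the subgroup $H$ is \emph{Zariski embedded} in $G$ if $\mathfrak{Z}_H=\mathfrak{Z}_G\upharpoonright_H$, and \emph{Markov embedded} in $G$ if $\mathfrak{M}_H=\mathfrak{M}_G\upharpoonright_H$. Let $H$ be an Abelian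 subgroup of a group $G$. If $H$ is Markov embedded in $G$, then $H$ is also Zariski embedded in $G$. -/

import Mathlib

namespace MarkovZariski

/-- A subset `S` of a group `G` is elementary algebraic if, for some `n > 0` (written `m + 1`),
`a₁, …, aₙ ∈ G` and `ε₁, …, εₙ ∈ {-1, 1}`, it is the set of all `x` with
`x ^ ε₁ * a₁ * x ^ ε₂ * a₂ * ⋯ * aₙ₋₁ * x ^ εₙ = aₙ`. -/
def IsElementaryAlgebraic {G : Type*} [Group G] (S : Set G) : Prop :=
  ∃ (m : ℕ) (a : Fin (m + 1) → G) (ε : Fin (m + 1) → ℤ),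
    (∀ i, ε i = -1 ∨ ε i = 1) ∧
    S = {x : G | (List.ofFn fun i : Fin m => x ^ ε i.castSucc * a i.castSucc).prod *
      x ^ ε (Fin.last m) = a (Fin.last m)}

/-- A finite union of elementary algebraic sets. -/
def IsFiniteUnionElementaryAlgebraic {G : Type*} [Group G] (S : Set G) : Prop :=
  ∃ F : Set (Set G), F.Finite ∧ (∀ A ∈ F, IsElementaryAlgebraic A) ∧ S = ⋃₀ F

/-- An algebraic set: an intersection of finite unions of elementary algebraic sets. -/
def IsAlgebraicSet {G : Type*} [Group G] (S : Set G) : Prop :=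
  ∃ F : Set (Set G), (∀ A ∈ F, IsFiniteUnionElementaryAlgebraic A) ∧ S = ⋂₀ F

/-- A set is unconditionally closed if it is closed in every Hausdorff group topology. -/
def IsUnconditionallyClosed {G : Type*} [Group G] (S : Set G) : Prop :=
  ∀ t : TopologicalSpace G, @IsTopologicalGroup G t _ → @T2Space G t → @IsClosed G t S

theorem isAlgebraicSet_empty {G : Type*} [Group G] : IsAlgebraicSet (∅ : Set G) :=
  ⟨{∅}, by
    rintro A rfl
    exact ⟨∅, Set.finite_empty, by simp, by simp⟩, by simp⟩

theorem isAlgebraicSet_sInter {G : Type*} [Group G] (𝒜 : Set (Set G))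
    (h : ∀ A ∈ 𝒜, IsAlgebraicSet A) : IsAlgebraicSet (⋂₀ 𝒜) := by
  choose! F hF hA using h
  refine ⟨⋃ A ∈ 𝒜, F A, ?_, ?_⟩
  · intro B hB
    simp only [Set.mem_iUnion] at hB
    obtain ⟨A, hA', hB⟩ := hB
    exact hF A hA' B hB
  · ext x
    simp only [Set.mem_sInter, Set.mem_iUnion]
    constructor
    · rintro hx B ⟨A, hA', hB⟩
      have := hx A hA'
      rw [hA A hA'] at this
      exact this B hB
    · intro hx A hA'
      rw [hA A hA']
      exact fun B hB => hx B ⟨A, hA', hB⟩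

theorem isAlgebraicSet_union {G : Type*} [Group G] (A : Set G) (hA : IsAlgebraicSet A)
    (B : Set G) (hB : IsAlgebraicSet B) : IsAlgebraicSet (A ∪ B) := by
  obtain ⟨F, hF, rfl⟩ := hA
  obtain ⟨K, hK, rfl⟩ := hB
  refine ⟨Set.image2 (· ∪ ·) F K, ?_, ?_⟩
  · rintro _ ⟨C, hC, D, hD, rfl⟩
    obtain ⟨P, hP, hP', rfl⟩ := hF C hC
    obtain ⟨Q, hQ, hQ', rfl⟩ := hK D hD
    exact ⟨P ∪ Q, hP.union hQ, fun E hE => hE.elim (hP' E) (hQ' E),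
      (Set.sUnion_union P Q).symm⟩
  · ext x
    simp only [Set.mem_union, Set.mem_sInter, Set.forall_mem_image2]
    constructor
    · rintro (h | h) C hC D hD
      · exact Or.inl (h C hC)
      · exact Or.inr (h D hD)
    · intro h
      by_contra! hn
      obtain ⟨⟨C, hC, hxC⟩, ⟨D, hD, hxD⟩⟩ := hn
      exact (h C hC D hD).elim hxC hxD

/-- The Zariski topology of a group: its closed sets are the algebraic sets. -/
abbrev zariskiTopology (G : Type*) [Group G] : TopologicalSpace G :=
  TopologicalSpace.ofClosed {S : Set G | IsAlgebraicSet S}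
    isAlgebraicSet_empty (fun 𝒜 h => isAlgebraicSet_sInter 𝒜 h) isAlgebraicSet_union

/-- The Markov topology of a group: its closed sets are the unconditionally closed sets. -/
abbrev markovTopology (G : Type*) [Group G] : TopologicalSpace G :=
  TopologicalSpace.ofClosed {S : Set G | IsUnconditionallyClosed S}
    (fun t _ _ => @isClosed_empty G t)
    (fun _ h t hg ht => @isClosed_sInter G t _ fun _ hA => h hA t hg ht)
    (fun _ hA _ hB t hg ht => @IsClosed.union G _ _ t (hA t hg ht) (hB t hg ht))

/-- `H` is Zariski embedded in `G` if the Zariski topology of `H` is the subspace topology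
that `H` inherits from the Zariski topology of `G`. -/
def IsZariskiEmbedded {G : Type*} [Group G] (H : Subgroup G) : Prop :=
  zariskiTopology H = (zariskiTopology G).induced ((↑) : H → G)

/-- `H` is Markov embedded in `G` if the Markov topology of `H` is the subspace topology
that `H` inherits from the Markov topology of `G`. -/
def IsMarkovEmbedded {G : Type*} [Group G] (H : Subgroup G) : Prop :=
  markovTopology H = (markovTopology G).induced ((↑) : H → G)

end MarkovZariski

/-! Traces of Zariski closed sets of `G` are Markov closed in `H` by the embedding hypothesis, so it
suffices that in an abelian group unconditionally closed sets are algebraic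
(`IsUnconditionallyClosed.isAlgebraicSet`).

Let `S` be unconditionally closed and `x` adherent to it for the sets `y ^ d = g`.
`IsPowerAdherent.exists_seq` gives terms `s k` in `S` and an `n` (0 playing infinity) such that `u k
= s k / x` is killed by `n` while its `d`-th powers are finite-to-one for `0 < d < n`. If the
characters tending to 0 along some reindexing of `u` separate points, they induce a Hausdorff group
topology in which `s`, so reindexed, tends to `x`; hence `x` lies in `S`. Such characters come from
Baire category in the compact space of sequences of characters of the countable subgroup generated
by `u`; density rests on `exists_index_forall_character_near`. -/

open Topology Filter
-- Extending characters of abelian groups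
namespace MarkovZariski

/-- Homomorphisms into a divisible group factor through any homomorphism with smaller kernel. -/
theorem exists_addMonoidHom_comp_eq {B Q D : Type*} [AddCommGroup B] [AddCommGroup Q]
    [AddCommGroup D] [DivisibleBy D ℤ] (φ : B →+ Q) (γ : B →+ D) (h : φ.ker ≤ γ.ker) :
    ∃ ψ : Q →+ D, ∀ b, ψ (φ b) = γ b := by
  obtain ⟨l, hl⟩ := (Module.Baer.of_divisible D).extension_property
    (QuotientAddGroup.kerLift φ).toIntLinearMap (QuotientAddGroup.kerLift_injective φ)
    (QuotientAddGroup.lift φ.ker γ h).toIntLinearMap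
  refine ⟨l.toAddMonoidHom, fun b => ?_⟩
  exact DFunLike.congr_fun hl (b : B ⧸ φ.ker)

theorem exists_addMonoidHom_apply_eq {Q D : Type*} [AddCommGroup Q] [AddCommGroup D]
    [DivisibleBy D ℤ] (a : Q) (w : D) (h : addOrderOf a • w = 0) :
    ∃ ψ : Q →+ D, ψ a = w := by
  obtain ⟨ψ, hψ⟩ := exists_addMonoidHom_comp_eq (zmultiplesHom Q a) (zmultiplesHom D w) (by
    intro z hz
    rw [AddMonoidHom.mem_ker, zmultiplesHom_apply] at hz ⊢
    obtain ⟨y, rfl⟩ := addOrderOf_dvd_iff_zsmul_eq_zero.mpr hz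
    rw [mul_comm, mul_smul, natCast_zsmul, h, smul_zero])
  exact ⟨ψ, by simpa using hψ 1⟩

theorem exists_character_ne_zero {Q : Type*} [AddCommGroup Q] {a : Q} (ha : a ≠ 0) :
    ∃ ψ : Q →+ UnitAddCircle, ψ a ≠ 0 := by
  have : Fact ((0 : ℝ) < 1) := ⟨one_pos⟩
  -- The character will send `a` to `1 / q`; for infinite order (`addOrderOf` zero) any `q > 1`
  -- serves.
  obtain ⟨q, hq, hdvd⟩ : ∃ q : ℕ, 1 < q ∧ q ∣ addOrderOf a := by
    rcases eq_or_ne (addOrderOf a) 0 with h0 | h0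
    · exact ⟨2, by norm_num, by simp [h0]⟩
    · refine ⟨addOrderOf a, ?_, dvd_rfl⟩
      have := mt AddMonoid.addOrderOf_eq_one_iff.mp ha
      omega
  have ho : addOrderOf (((1 : ℝ) / q : ℝ) : UnitAddCircle) = q :=
    AddCircle.addOrderOf_period_div (by omega)
  obtain ⟨ψ, hψ⟩ := exists_addMonoidHom_apply_eq a (((1 : ℝ) / q : ℝ) : UnitAddCircle)
    (addOrderOf_dvd_iff_nsmul_eq_zero.mp (ho.symm ▸ hdvd))
  refine ⟨ψ, fun h => ?_⟩
  rw [← hψ, h, addOrderOf_zero] at ho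
  omega

/-- Finitely generated abelian groups: an infinite subset is unbounded in some coordinate. -/
theorem exists_addMonoidHom_int_image_infinite {L : Type*} [AddCommGroup L] [AddGroup.FG L]
    {I : Set L} (hI : I.Infinite) : ∃ c : L →+ ℤ, (c '' I).Infinite := by
  by_contra! hc
  obtain ⟨n, ι, _, p, hp, e, ⟨f⟩⟩ := AddCommGroup.equiv_free_prod_directSum_zmod L
  have : ∀ i, NeZero (p i ^ e i) := fun i => ⟨pow_ne_zero _ (hp i).ne_zero⟩
  classical
  have hfin : Finite (DirectSum ι fun i => ZMod (p i ^ e i)) :=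
    Finite.of_injective (fun x i => x i) DFunLike.coe_injective
  let g : L → (Fin n → ℤ) × DirectSum ι fun i => ZMod (p i ^ e i) :=
    fun x => (fun i => (f x).1 i, (f x).2)
  have hg : Function.Injective g := by
    intro x y h
    simp only [g, Prod.mk.injEq] at h
    exact f.injective (Prod.ext (Finsupp.ext fun i => congrFun h.1 i) h.2)
  refine hI (Set.Finite.of_finite_image (f := g) ?_ hg.injOn)
  let c : Fin n → L →+ ℤ := fun i =>
    (Finsupp.applyAddHom i).comp ((AddMonoidHom.fst _ _).comp f.toAddMonoidHom)
  refine ((Set.Finite.pi' fun i => hc (c i)).prod (Set.toFinite Set.univ)).subset ?_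
  rintro _ ⟨x, hx, rfl⟩
  exact ⟨fun i => ⟨x, hx, rfl⟩, trivial⟩

/-- A character may be changed off a subgroup so as to take at `a` any given value that is
compatible with the order of `a` modulo that subgroup. -/
theorem exists_character_eqOn_apply_eq {K : Type*} [AddCommGroup K] (L : AddSubgroup K) (a : K)
    (χ : K →+ UnitAddCircle) (r : ℝ)
    (hr : (r : UnitAddCircle) = χ (addOrderOf (a : K ⧸ L) • a))
    (h0 : addOrderOf (a : K ⧸ L) = 0 → r = 0) :
    ∃ χ' : K →+ UnitAddCircle, (∀ x ∈ L, χ' x = χ x) ∧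
      χ' a = ((r / addOrderOf (a : K ⧸ L) : ℝ) : UnitAddCircle) := by
  set q := addOrderOf (a : K ⧸ L) with hq
  obtain ⟨ψ, hψ⟩ := exists_addMonoidHom_apply_eq (a : K ⧸ L)
    (((r / q : ℝ) : UnitAddCircle) - χ a) (by
      rw [← hq, smul_sub, ← map_nsmul, ← hr, ← AddCircle.coe_nsmul, nsmul_eq_mul]
      -- Infinite order modulo `L` reads `q = 0`; the prescribed value is then `r / 0 = 0`,
      -- consistent because `r = 0`.
      rcases eq_or_ne q 0 with h | h
      · simp [h, h0 h]
      · rw [mul_div_cancel₀ _ (by exact_mod_cast h), sub_self])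
  refine ⟨χ + ψ.comp (QuotientAddGroup.mk' L), fun x hx => ?_, ?_⟩
  · have : ((x : K) : K ⧸ L) = 0 := (QuotientAddGroup.eq_zero_iff x).mpr hx
    simp [this]
  · simp [hψ]

end MarkovZariski
-- Perturbing characters at a term of a sequence
namespace MarkovZariski

theorem exists_coe_eq_unitAddCircle (t : UnitAddCircle) :
    ∃ r : ℝ, (r : UnitAddCircle) = t ∧ |r| ≤ 1 ∧ (t = 0 → r = 0) := by
  have : Fact ((0 : ℝ) < 1) := ⟨one_pos⟩
  rcases eq_or_ne t 0 with rfl | ht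
  · exact ⟨0, by simp, by simp, fun _ => rfl⟩
  · obtain ⟨r, hr, rfl⟩ := AddCircle.coe_image_Ico_eq (1 : ℝ) 0 ▸ Set.mem_univ t
    refine ⟨r, rfl, ?_, fun h => absurd h ht⟩
    rw [abs_of_nonneg hr.1]
    linarith [hr.2]

theorem norm_coe_unitAddCircle_le (r : ℝ) : ‖(r : UnitAddCircle)‖ ≤ |r| :=
  UnitAddCircle.norm_eq.trans_le (by simpa using round_le r 0)

/-- If `a` has order at least `N` modulo `L`, a character may be changed off `L` to have value
of norm at most `1 / N` at `a`. -/
theorem exists_character_eqOn_norm_le_inv {K : Type*} [AddCommGroup K] (L : AddSubgroup K) (a : K)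
    (N : ℕ) (hN : 0 < N)
    (ha : ∀ d, 0 < d → d < N → d • a ∉ L) (χ : K →+ UnitAddCircle) :
    ∃ χ' : K →+ UnitAddCircle, (∀ x ∈ L, χ' x = χ x) ∧ ‖χ' a‖ ≤ 1 / N := by
  obtain ⟨r, hr, hr1, hr0⟩ := exists_coe_eq_unitAddCircle (χ (addOrderOf (a : K ⧸ L) • a))
  obtain ⟨χ', h1, h2⟩ := exists_character_eqOn_apply_eq L a χ r hr
    (fun h => hr0 (by simp [h]))
  refine ⟨χ', h1, ?_⟩
  rw [h2]
  refine (norm_coe_unitAddCircle_le _).trans ?_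
  rcases Nat.eq_zero_or_pos (addOrderOf (a : K ⧸ L)) with h | h
  · simp [h]
  · have hle : N ≤ addOrderOf (a : K ⧸ L) := by
      by_contra! hlt
      refine ha _ h hlt ?_
      rw [← QuotientAddGroup.eq_zero_iff, QuotientAddGroup.mk_nsmul]
      exact addOrderOf_nsmul_eq_zero _
    rw [abs_div, Nat.abs_cast]
    have : (0 : ℝ) < N := by exact_mod_cast hN
    gcongr

/-- The order of `a` modulo `L` is exactly `n`, and `n • a = 0`, so the value 0 is compatible with
any character on `L`. -/
theorem exists_character_eqOn_apply_eq_zero {K : Type*} [AddCommGroup K] (L : AddSubgroup K)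
    (a : K) (n : ℕ) (hn : n • a = 0) (hn0 : 0 < n)
    (ha : ∀ d, 0 < d → d < n → d • a ∉ L) (χ : K →+ UnitAddCircle) :
    ∃ χ' : K →+ UnitAddCircle, (∀ x ∈ L, χ' x = χ x) ∧ χ' a = 0 := by
  have hq : addOrderOf (a : K ⧸ L) = n := by
    have hdvd : addOrderOf (a : K ⧸ L) ∣ n := by
      rw [addOrderOf_dvd_iff_nsmul_eq_zero, ← QuotientAddGroup.mk_nsmul, hn]
      rfl
    have hpos := Nat.pos_of_dvd_of_pos hdvd hn0
    refine (Nat.le_of_dvd hn0 hdvd).antisymm ?_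
    by_contra! hlt
    refine ha _ hpos hlt ?_
    rw [← QuotientAddGroup.eq_zero_iff, QuotientAddGroup.mk_nsmul]
    exact addOrderOf_nsmul_eq_zero _
  obtain ⟨χ', h1, h2⟩ := exists_character_eqOn_apply_eq L a χ 0 (by simp [hq, hn])
    (fun _ => rfl)
  exact ⟨χ', h1, by simpa using h2⟩

/-- Adding to `χ` a multiple of `c` reduced mod 1 cancels its value at `u k`. When `|c (u k)|` is
large the multiplier is small, so values on `F` hardly move. -/
theorem exists_character_near_of_unbounded {K : Type*} [AddCommGroup K] (u : ℕ → K)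
    (F : Finset K) {ε : ℝ} (hε : 0 < ε) (c : K →+ ℝ) (hc : ∀ B : ℝ, ∃ k, B < |c (u k)|) :
    ∃ k, ∀ χ : K →+ UnitAddCircle, ∃ χ' : K →+ UnitAddCircle,
      ‖χ' (u k)‖ < ε ∧ ∀ x ∈ F, ‖χ' x - χ x‖ < ε := by
  obtain ⟨k, hk⟩ := hc ((∑ x ∈ F, |c x|) / ε)
  refine ⟨k, fun χ => ?_⟩
  have hsum : 0 ≤ ∑ x ∈ F, |c x| := Finset.sum_nonneg fun _ _ => abs_nonneg _
  have hpos : 0 < |c (u k)| := lt_of_le_of_lt (by positivity) hk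
  rw [div_lt_iff₀ hε] at hk
  obtain ⟨r, hr, hr1, -⟩ := exists_coe_eq_unitAddCircle (-χ (u k))
  let ψ : K →+ UnitAddCircle := (QuotientAddGroup.mk' _).comp
    ((AddMonoidHom.mulLeft (r / c (u k))).comp c)
  have hψ : ∀ x, ψ x = ((r / c (u k) * c x : ℝ) : UnitAddCircle) := fun _ => rfl
  refine ⟨χ + ψ, ?_, fun x hx => ?_⟩
  · rw [AddMonoidHom.add_apply, hψ, div_mul_cancel₀ _ (abs_pos.mp hpos), hr, add_neg_cancel]
    simpa using hε
  · rw [AddMonoidHom.add_apply, add_sub_cancel_left, hψ]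
    refine (norm_coe_unitAddCircle_le _).trans_lt ?_
    rw [abs_mul, abs_div, div_mul_eq_mul_div, div_lt_iff₀ hpos]
    have h1 : |c x| ≤ ∑ x ∈ F, |c x| :=
      Finset.single_le_sum (f := fun x => |c x|) (fun _ _ => abs_nonneg _) hx
    have h2 : |r| * |c x| ≤ 1 * |c x| := by gcongr
    linarith

/-- If infinitely many terms of `u` have a fixed positive multiple in a finitely generated
subgroup, and these multiples take infinitely many values, then `u` is unbounded under some
homomorphism to the reals. -/
theorem exists_addMonoidHom_real_unbounded {K : Type*} [AddCommGroup K] (u : ℕ → K)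
    (L : AddSubgroup K) [AddGroup.FG L] (d : ℕ) (hf : ∀ g, {k | d • u k = g}.Finite)
    (hinf : {k | d • u k ∈ L}.Infinite) (hd : 0 < d) :
    ∃ c : K →+ ℝ, ∀ B : ℝ, ∃ k, B < |c (u k)| := by
  have hI : {y : L | ∃ k, d • u k = y}.Infinite := by
    intro hfin
    refine hinf ((hfin.biUnion (t := fun y => {k | d • u k = (y : K)}) fun y _ => hf y).subset ?_)
    intro k hk
    simp only [Set.mem_iUnion]
    exact ⟨⟨_, hk⟩, ⟨k, rfl⟩, rfl⟩
  obtain ⟨c₀, hc₀⟩ := exists_addMonoidHom_int_image_infinite hI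
  obtain ⟨c, hc⟩ := exists_addMonoidHom_comp_eq L.subtype ((Int.castAddHom ℝ).comp c₀) (by
    rw [AddSubgroup.ker_subtype]
    exact bot_le)
  refine ⟨c, fun B => ?_⟩
  by_contra! hB
  refine hc₀ ((Set.finite_Icc (-⌈d * B⌉) ⌈d * B⌉).subset ?_)
  rintro _ ⟨y, ⟨k, hk⟩, rfl⟩
  have h1 : (c₀ y : ℝ) = d * c (u k) := by
    have := hc y
    rw [AddSubgroup.subtype_apply, ← hk, map_nsmul, nsmul_eq_mul] at this
    exact this.symm
  have h2 : |(c₀ y : ℝ)| ≤ ⌈d * B⌉ := by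
    rw [h1, abs_mul, Nat.abs_cast]
    exact le_trans (by gcongr; exact hB k) (Int.le_ceil _)
  rw [Set.mem_Icc, ← abs_le]
  exact_mod_cast h2

/-- A sequence `u` in an abelian group annihilated by `n` (possibly `0`), such that `k ↦ d • u k`
is finite-to-one whenever `0 < d < n` (whenever `0 < d`, if `n = 0`), has a term at which suitable
small perturbations of all characters are close to `0`. -/
theorem exists_index_forall_character_near {K : Type*} [AddCommGroup K] (u : ℕ → K) (n : ℕ)
    (hn : ∀ k, n • u k = 0)
    (hf : ∀ d, 0 < d → (n = 0 ∨ d < n) → ∀ g, {k | d • u k = g}.Finite)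
    (F : Finset K) {ε : ℝ} (hε : 0 < ε) :
    ∃ k, ∀ χ : K →+ UnitAddCircle, ∃ χ' : K →+ UnitAddCircle,
      ‖χ' (u k)‖ < ε ∧ ∀ x ∈ F, ‖χ' x - χ x‖ < ε := by
  by_cases hc : ∃ c : K →+ ℝ, ∀ B : ℝ, ∃ k, B < |c (u k)|
  · obtain ⟨c, hc⟩ := hc
    exact exists_character_near_of_unbounded u F hε c hc
  let L := AddSubgroup.closure (F : Set K)
  have : AddGroup.FG L := AddGroup.closure_finset_fg F
  have hL : ∀ x ∈ F, x ∈ L := fun x hx => AddSubgroup.subset_closure hx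
  have hfin : ∀ d, 0 < d → (n = 0 ∨ d < n) → {k | d • u k ∈ L}.Finite := by
    intro d hd hdn
    by_contra hinf
    exact hc (exists_addMonoidHom_real_unbounded u L d (hf d hd hdn) hinf hd)
  -- Each `d` excludes only finitely many `k`, so some term has order at least `N` modulo `L`.
  have key : ∀ N, (n = 0 ∨ N ≤ n) → ∃ k, ∀ d, 0 < d → d < N → d • u k ∉ L := by
    intro N hN
    have h := (Set.finite_Ioo 0 N).biUnion (t := fun d => {k | d • u k ∈ L})
      fun d hd => hfin d hd.1 (hN.imp_right hd.2.trans_le)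
    obtain ⟨k, hk⟩ := h.infinite_compl.nonempty
    refine ⟨k, fun d h0 hd hmem => hk ?_⟩
    simp only [Set.mem_iUnion]
    exact ⟨d, ⟨h0, hd⟩, hmem⟩
  rcases Nat.eq_zero_or_pos n with h0 | hpos
  · obtain ⟨N, hN⟩ := exists_nat_one_div_lt hε
    obtain ⟨k, hk⟩ := key (N + 1) (Or.inl h0)
    refine ⟨k, fun χ => ?_⟩
    obtain ⟨χ', h1, h2⟩ := exists_character_eqOn_norm_le_inv L (u k) (N + 1) N.succ_pos hk χ
    refine ⟨χ', h2.trans_lt (by exact_mod_cast hN), fun x hx => ?_⟩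
    rw [h1 x (hL x hx), sub_self, norm_zero]
    exact hε
  · obtain ⟨k, hk⟩ := key n (Or.inr le_rfl)
    refine ⟨k, fun χ => ?_⟩
    obtain ⟨χ', h1, h2⟩ := exists_character_eqOn_apply_eq_zero L (u k) n (hn k) hpos hk χ
    refine ⟨χ', by rwa [h2, norm_zero], fun x hx => ?_⟩
    rw [h1 x (hL x hx), sub_self, norm_zero]
    exact hε

end MarkovZariski
-- Baire category in the space of character sequences
namespace MarkovZariski

/-- The space of sequences of characters of `K`, with the topology of pointwise convergence. -/
abbrev CharacterSequence (K : Type*) [AddCommGroup K] : Type _ :=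
  {f : K × ℕ → UnitAddCircle // ∀ x y i, f (x + y, i) = f (x, i) + f (y, i)}

namespace CharacterSequence

variable {K : Type*} [AddCommGroup K]

instance : CompactSpace (CharacterSequence K) := by
  have : IsClosed {f : K × ℕ → UnitAddCircle | ∀ x y i, f (x + y, i) = f (x, i) + f (y, i)} := by
    simp only [Set.ofPred_forall]
    refine isClosed_iInter fun x => isClosed_iInter fun y => isClosed_iInter fun i => ?_
    exact isClosed_eq (by fun_prop) (by fun_prop)
  exact isCompact_iff_compactSpace.mp this.isCompact

/-- The `i`-th character of the sequence. -/
def character (f : CharacterSequence K) (i : ℕ) : K →+ UnitAddCircle :=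
  AddMonoidHom.mk' (fun x => f.1 (x, i)) fun x y => f.2 x y i

/-- The sequence with given characters. -/
def ofCharacters (χ : ℕ → K →+ UnitAddCircle) : CharacterSequence K :=
  ⟨fun p => χ p.2 p.1, fun x y i => map_add (χ i) x y⟩

instance : Nonempty (CharacterSequence K) := ⟨ofCharacters fun _ => 0⟩

theorem continuous_character_apply (i : ℕ) (x : K) :
    Continuous fun f : CharacterSequence K => f.character i x :=
  (continuous_apply (x, i)).comp continuous_subtype_val

theorem dense_of_forall_finset {U : Set (CharacterSequence K)}
    (h : ∀ (f : CharacterSequence K) (F : Finset K) (m : ℕ) (ε : ℝ), 0 < ε →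
      ∃ g ∈ U, ∀ x ∈ F, ∀ i < m, ‖g.character i x - f.character i x‖ < ε) : Dense U := by
  intro f
  have hb : (𝓝 f).HasBasis
      (fun b : Set (K × ℕ) × (K × ℕ → ℝ) => b.1.Finite ∧ ∀ p ∈ b.1, 0 < b.2 p)
      (fun b => Subtype.val ⁻¹' b.1.pi fun p => Metric.ball (f.1 p) (b.2 p)) := by
    rw [nhds_subtype_eq_comap, nhds_pi]
    exact (Filter.hasBasis_pi fun p => Metric.nhds_basis_ball).comap _
  rw [mem_closure_iff_nhds_basis' hb]
  rintro ⟨I, r⟩ ⟨hI, hr⟩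
  simp only at hI hr
  classical
  obtain ⟨ε, hε, hεr⟩ : ∃ ε : ℝ, 0 < ε ∧ ∀ p ∈ I, ε ≤ r p := by
    rcases I.eq_empty_or_nonempty with rfl | hne
    · exact ⟨1, one_pos, by simp⟩
    · obtain ⟨p, hp, hmin⟩ := hI.exists_minimalFor r I hne
      refine ⟨r p, hr p hp, fun q hq => ?_⟩
      by_contra! hlt
      exact absurd (hmin hq hlt.le) hlt.not_ge
  obtain ⟨g, hg, hgf⟩ := h f (hI.toFinset.image Prod.fst) (hI.toFinset.sup Prod.snd + 1) ε hε
  refine ⟨g, fun p hp => ?_, hg⟩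
  rw [mem_ball_iff_norm]
  refine (hgf p.1 ?_ p.2 ?_).trans_le (hεr p hp)
  · exact Finset.mem_image_of_mem _ (hI.mem_toFinset.mpr hp)
  · exact Nat.lt_succ_of_le (Finset.le_sup (f := Prod.snd) (hI.mem_toFinset.mpr hp))

theorem dense_setOf_exists_ne_zero {a : K} (ha : a ≠ 0) :
    Dense {f : CharacterSequence K | ∃ i, f.character i a ≠ 0} := by
  refine dense_of_forall_finset fun f F m ε hε => ?_
  obtain ⟨ψ, hψ⟩ := exists_character_ne_zero ha
  -- Only coordinates below `m` are constrained, so coordinate `m` is free to detect `a`.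
  refine ⟨ofCharacters fun i => if i < m then f.character i else ψ, ⟨m, ?_⟩, fun x _ i hi => ?_⟩
  · change (if m < m then f.character m else ψ) a ≠ 0
    simpa using hψ
  · change ‖(if i < m then f.character i else ψ) x - f.character i x‖ < ε
    simpa [hi] using hε

theorem isOpen_setOf_exists_ne_zero (a : K) :
    IsOpen {f : CharacterSequence K | ∃ i, f.character i a ≠ 0} := by
  rw [Set.ofPred_exists]
  exact isOpen_iUnion fun i => isOpen_ne_fun (continuous_character_apply i a) continuous_const

theorem isOpen_setOf_exists_norm_lt (u : ℕ → K) (m : ℕ) (ε : ℝ) :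
    IsOpen {f : CharacterSequence K | ∃ k, ∀ i < m, ‖f.character i (u k)‖ < ε} := by
  rw [Set.ofPred_exists]
  refine isOpen_iUnion fun k => ?_
  have : {f : CharacterSequence K | ∀ i < m, ‖f.character i (u k)‖ < ε} =
      ⋂ i ∈ Set.Iio m, {f : CharacterSequence K | ‖f.character i (u k)‖ < ε} := by
    ext
    simp
  rw [this]
  exact (Set.finite_Iio m).isOpen_biInter fun i _ =>
    isOpen_lt (continuous_character_apply i _).norm continuous_const

theorem dense_setOf_exists_norm_lt (u : ℕ → K) (n : ℕ) (hn : ∀ k, n • u k = 0)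
    (hf : ∀ d, 0 < d → (n = 0 ∨ d < n) → ∀ g, {k | d • u k = g}.Finite) (m : ℕ) {ε : ℝ}
    (hε : 0 < ε) :
    Dense {f : CharacterSequence K | ∃ k, ∀ i < m, ‖f.character i (u k)‖ < ε} := by
  refine dense_of_forall_finset fun f F m' δ hδ => ?_
  -- The index `k` does not depend on the character, so one `k` serves all coordinates at once.
  obtain ⟨k, hk⟩ := exists_index_forall_character_near u n hn hf F (lt_min hε hδ)
  choose χ hχ hχF using hk
  exact ⟨ofCharacters fun i => χ (f.character i),
    ⟨k, fun i _ => (hχ _).trans_le (min_le_left _ _)⟩,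
    fun x hx i _ => (hχF _ x hx).trans_le (min_le_right _ _)⟩

end CharacterSequence

open CharacterSequence in
theorem exists_characters_separating_tendsto {K : Type*} [AddCommGroup K] [Countable K]
    (u : ℕ → K) (n : ℕ) (hn : ∀ k, n • u k = 0)
    (hf : ∀ d, 0 < d → (n = 0 ∨ d < n) → ∀ g, {k | d • u k = g}.Finite) :
    ∃ (χ : ℕ → K →+ UnitAddCircle) (φ : ℕ → ℕ), (∀ a ≠ 0, ∃ i, χ i a ≠ 0) ∧
      ∀ i, Tendsto (fun m => χ i (u (φ m))) atTop (𝓝 0) := by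
  let U : {a : K // a ≠ 0} ⊕ ℕ → Set (CharacterSequence K) := Sum.elim
    (fun a => {f | ∃ i, f.character i a ≠ 0})
    fun m => {f | ∃ k, ∀ i < m, ‖f.character i (u k)‖ < 1 / ((m : ℝ) + 1)}
  have hU : Dense (⋂ j, U j) := by
    refine dense_iInter_of_isOpen ?_ ?_
    · rintro (a | m)
      · exact isOpen_setOf_exists_ne_zero a.1
      · exact isOpen_setOf_exists_norm_lt u m _
    · rintro (a | m)
      · exact dense_setOf_exists_ne_zero a.2
      · exact dense_setOf_exists_norm_lt u n hn hf m Nat.one_div_pos_of_nat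
  obtain ⟨f, hfU⟩ := hU.nonempty
  rw [Set.mem_iInter] at hfU
  have hf1 : ∀ a : {a : K // a ≠ 0}, ∃ i, f.character i a ≠ 0 := fun a => hfU (Sum.inl a)
  have hf2 : ∀ m : ℕ, ∃ k, ∀ i < m, ‖f.character i (u k)‖ < 1 / ((m : ℝ) + 1) :=
    fun m => hfU (Sum.inr m)
  choose φ hφ using hf2
  refine ⟨f.character, φ, fun a ha => hf1 ⟨a, ha⟩, fun i => ?_⟩
  refine squeeze_zero_norm' ?_ tendsto_one_div_add_atTop_nhds_zero_nat
  filter_upwards [eventually_gt_atTop i] with m hm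
  exact (hφ m i hm).le

end MarkovZariski
-- Unconditionally closed sets in abelian groups
namespace MarkovZariski

section Abelian

variable {A : Type*} [CommGroup A]

/-- The point `x` lies in every finite union of sets `{y | y ^ d = g}` with `d > 0` that
contains `S`. -/
def IsPowerAdherent (S : Set A) (x : A) : Prop :=
  ∀ P : Finset (ℕ × A), (∀ p ∈ P, 0 < p.1) → (∀ y ∈ S, ∃ p ∈ P, y ^ p.1 = p.2) →
    ∃ p ∈ P, x ^ p.1 = p.2

theorem IsPowerAdherent.mono {S T : Set A} {x : A} (h : IsPowerAdherent S x) (hST : S ⊆ T) :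
    IsPowerAdherent T x :=
  fun P hP hT => h P hP fun y hy => hT y (hST hy)

theorem isElementaryAlgebraic_setOf_pow_eq {G : Type*} [Group G] {d : ℕ} (hd : 0 < d) (g : G) :
    IsElementaryAlgebraic {y : G | y ^ d = g} := by
  obtain ⟨m, rfl⟩ := Nat.exists_eq_succ_of_ne_zero hd.ne'
  refine ⟨m, fun i => if i = Fin.last m then g else 1, fun _ => 1, fun _ => Or.inr rfl, ?_⟩
  ext y
  simp [Fin.castSucc_ne_last, List.ofFn_const, pow_succ]

theorem isAlgebraicSet_of_forall_isPowerAdherent {S : Set A}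
    (h : ∀ x, IsPowerAdherent S x → x ∈ S) : IsAlgebraicSet S := by
  refine ⟨{B | IsFiniteUnionElementaryAlgebraic B ∧ S ⊆ B}, fun B hB => hB.1, ?_⟩
  refine Set.Subset.antisymm (fun x hx B hB => hB.2 hx) fun x hx => h x fun P hP hS => ?_
  have := hx (⋃₀ ((fun p : ℕ × A => {y : A | y ^ p.1 = p.2}) '' P))
    ⟨⟨_, P.finite_toSet.image _, ?_, rfl⟩, fun y hy => ?_⟩
  · simpa using this
  · rintro _ ⟨p, hp, rfl⟩
    exact isElementaryAlgebraic_setOf_pow_eq (hP p hp) _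
  · simpa using hS y hy

/-- If finitely many pieces cover `S` and `x` is adherent to none, the union of the covers
witnessing this covers `S` and misses `x`. -/
theorem IsPowerAdherent.exists_forall_pow_ne {S : Set A} {x : A} (h : IsPowerAdherent S x)
    (P : Finset (ℕ × A)) (hP : ∀ p ∈ P, ¬IsPowerAdherent {y ∈ S | y ^ p.1 = p.2} x) :
    ∃ y ∈ S, ∀ p ∈ P, y ^ p.1 ≠ p.2 := by
  classical
  by_contra! hcov
  unfold IsPowerAdherent at hP
  push Not at hP
  choose! Q hQ0 hQ hQx using hP
  obtain ⟨q, hq, hxq⟩ := h (P.biUnion Q)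
    (fun q hq => by
      obtain ⟨p, hp, hq⟩ := Finset.mem_biUnion.mp hq
      exact hQ0 p hp q hq)
    (fun y hy => by
      obtain ⟨p, hp, hyp⟩ := hcov y hy
      obtain ⟨q, hq, hyq⟩ := hQ p hp y ⟨hy, hyp⟩
      exact ⟨q, Finset.mem_biUnion.mpr ⟨p, hp, hq⟩, hyq⟩)
  obtain ⟨p, hp, hq⟩ := Finset.mem_biUnion.mp hq
  exact hQx p hp q hq hxq

theorem IsPowerAdherent.exists_minimal_exponent {S : Set A} {x : A} (h : IsPowerAdherent S x) :
    ∃ n : ℕ, IsPowerAdherent {y ∈ S | y ^ n = x ^ n} x ∧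
      ∀ d, 0 < d → (n = 0 ∨ d < n) → ¬IsPowerAdherent {y ∈ S | y ^ d = x ^ d} x := by
  classical
  by_cases hex : ∃ n, 0 < n ∧ IsPowerAdherent {y ∈ S | y ^ n = x ^ n} x
  · refine ⟨Nat.find hex, (Nat.find_spec hex).2, fun d hd hdn hadh => ?_⟩
    rcases hdn with h0 | hlt
    · exact (Nat.find_spec hex).1.ne' h0
    · exact Nat.find_min hex hlt ⟨hd, hadh⟩
  · refine ⟨0, by simpa using h, fun d hd _ hadh => hex ⟨d, hd, hadh⟩⟩

theorem IsPowerAdherent.exists_seq {S : Set A} {x : A} (h : IsPowerAdherent S x) :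
    ∃ (n : ℕ) (s : ℕ → A), (∀ k, s k ∈ S) ∧ (∀ k, s k ^ n = x ^ n) ∧
      ∀ d, 0 < d → (n = 0 ∨ d < n) → ∀ g, {k | s k ^ d = g}.Finite := by
  classical
  obtain ⟨n, hn, hmin⟩ := h.exists_minimal_exponent
  -- The second coordinate is a growing bound on the exponents `d` at which a new term must avoid
  -- the powers of earlier ones.
  obtain ⟨s, hs, hr⟩ := exists_seq_of_forall_finset_exists
    (fun p : A × ℕ => p.1 ∈ {y ∈ S | y ^ n = x ^ n})
    (fun p q => p.2 < q.2 ∧ ∀ d, 0 < d → (n = 0 ∨ d < n) → d ≤ q.2 → q.1 ^ d ≠ p.1 ^ d) (by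
      intro T _
      let N := T.sup Prod.snd + 1
      obtain ⟨y, hy, hyP⟩ := hn.exists_forall_pow_ne
        (((Finset.range (N + 1)).filter fun d => 0 < d ∧ (n = 0 ∨ d < n)).biUnion
          fun d => T.image fun p => (d, p.1 ^ d)) (by
        simp only [Finset.mem_biUnion, Finset.mem_filter, Finset.mem_image]
        rintro _ ⟨d, ⟨-, hd, hdn⟩, p, -, rfl⟩ hadh
        -- Either minimality of `n` forbids adherence, or `y ^ d = p.1 ^ d` alone already excludes
        -- `x`.
        by_cases hg : x ^ d = p.1 ^ d
        · refine hmin d hd hdn (hadh.mono ?_)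
          rintro y ⟨⟨hyS, -⟩, hy⟩
          exact ⟨hyS, hy.trans hg.symm⟩
        · obtain ⟨q, hq, hxq⟩ := hadh {(d, p.1 ^ d)} (by simpa using hd)
            fun y hy => ⟨_, Finset.mem_singleton_self _, hy.2⟩
          rw [Finset.mem_singleton] at hq
          subst hq
          exact hg hxq)
      refine ⟨(y, N), hy, fun p hp => ⟨Nat.lt_succ_of_le (Finset.le_sup (f := Prod.snd) hp),
        fun d hd hdn hdN => ?_⟩⟩
      refine hyP (d, p.1 ^ d) (Finset.mem_biUnion.mpr ⟨d, ?_, Finset.mem_image_of_mem _ hp⟩)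
      simpa [hd, hdn] using Nat.lt_succ_of_le hdN)
  have hmono : StrictMono fun k => (s k).2 := fun i j hij => (hr i j hij).1
  refine ⟨n, fun k => (s k).1, fun k => (hs k).1, fun k => (hs k).2, fun d hd hdn g => ?_⟩
  -- From index `d` on, the `d`-th powers are distinct, since the bound at index `k` is at least
  -- `k`.
  have hsub : ({k | (s k).1 ^ d = g} ∩ Set.Ici d).Subsingleton := by
    have hlt : ∀ i j, i < j → d ≤ j → (s i).1 ^ d = g → (s j).1 ^ d ≠ g :=
      fun i j hij hdj hi hj =>
        (hr i j hij).2 d hd hdn (hdj.trans (hmono.id_le j)) (hj.trans hi.symm)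
    rintro i ⟨hi, hdi⟩ j ⟨hj, hdj⟩
    rcases lt_trichotomy i j with hij | hij | hij
    · exact absurd hj (hlt i j hij hdj hi)
    · exact hij
    · exact absurd hi (hlt j i hij hdi hj)
  refine ((Set.finite_Iio d).union hsub.finite).subset fun k hk => ?_
  rcases lt_or_ge k d with hkd | hkd
  · exact Or.inl hkd
  · exact Or.inr ⟨hk, hkd⟩

/-- A sequence with finite-to-one multiples has a reindexing such that the characters of the whole
group along which it tends to `0` separate points. -/
theorem exists_subseq_characters_separating {B : Type*} [AddCommGroup B] (u : ℕ → B) (n : ℕ)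
    (hn : ∀ k, n • u k = 0)
    (hf : ∀ d, 0 < d → (n = 0 ∨ d < n) → ∀ g, {k | d • u k = g}.Finite) :
    ∃ φ : ℕ → ℕ, ∀ a ≠ 0, ∃ χ : B →+ UnitAddCircle, χ a ≠ 0 ∧
      Tendsto (fun m => χ (u (φ m))) atTop (𝓝 0) := by
  let K := (Finsupp.linearCombination ℤ u).toAddMonoidHom.range
  have hK : ∀ k, u k ∈ K := fun k => ⟨Finsupp.single k 1, by simp⟩
  have : Countable K := (Set.countable_range (Finsupp.linearCombination ℤ u)).to_subtype
  obtain ⟨χ, φ, hsep, hφ⟩ := exists_characters_separating_tendsto (fun k => (⟨u k, hK k⟩ : K)) n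
    (fun k => Subtype.ext (hn k)) fun d hd hdn g => by
      simpa [Subtype.ext_iff] using hf d hd hdn g
  refine ⟨φ, fun a ha => ?_⟩
  by_cases haK : a ∈ K
  · obtain ⟨i, hi⟩ := hsep ⟨a, haK⟩ (by simpa [Subtype.ext_iff] using ha)
    obtain ⟨ψ, hψ⟩ := exists_addMonoidHom_comp_eq K.subtype (χ i) (by
      rw [AddSubgroup.ker_subtype]
      exact bot_le)
    exact ⟨ψ, by rwa [← hψ ⟨a, haK⟩] at hi, (hφ i).congr fun m => (hψ _).symm⟩
  -- Points outside `K` are detected by characters vanishing on `K`, hence on all of `u`.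
  · obtain ⟨ψ, hψ⟩ := exists_character_ne_zero (a := (a : B ⧸ K))
      (by rwa [Ne, QuotientAddGroup.eq_zero_iff])
    refine ⟨ψ.comp (QuotientAddGroup.mk' K), hψ, tendsto_const_nhds.congr fun m => ?_⟩
    have : (u (φ m) : B ⧸ K) = 0 := (QuotientAddGroup.eq_zero_iff _).mpr (hK _)
    simp [this]

theorem IsUnconditionallyClosed.mem_of_isPowerAdherent {S : Set A}
    (hS : IsUnconditionallyClosed S) {x : A} (h : IsPowerAdherent S x) : x ∈ S := by
  obtain ⟨n, s, hsS, hsn, hsf⟩ := h.exists_seq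
  obtain ⟨φ, hφ⟩ := exists_subseq_characters_separating
    (fun k => Additive.ofMul (s k / x)) n
    (fun k => by
      rw [← ofMul_pow, div_pow, hsn, div_self', ofMul_one])
    (fun d hd hdn g => (hsf d hd hdn (g.toMul * x ^ d)).subset fun k hk => by
      have hk' : (s k / x) ^ d = g.toMul := hk
      rw [Set.mem_ofPred_eq, ← hk', div_pow, div_mul_cancel])
  let X := {χ : Additive A →+ UnitAddCircle //
    Tendsto (fun m => χ (Additive.ofMul (s (φ m) / x))) atTop (𝓝 0)}
  let Φ : A →* Multiplicative (X → UnitAddCircle) :=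
    AddMonoidHom.toMultiplicativeRight (AddMonoidHom.mk' (fun a χ => χ.1 a)
      fun a b => funext fun χ => map_add χ.1 a b)
  have hΦ : Function.Injective Φ := by
    rw [injective_iff_map_eq_one]
    intro a ha
    by_contra hne
    obtain ⟨χ, hχ, hlim⟩ := hφ (Additive.ofMul a) hne
    exact hχ (congrFun (congrArg Multiplicative.toAdd ha) ⟨χ, hlim⟩)
  let t : TopologicalSpace A := TopologicalSpace.induced Φ inferInstance
  have hind : IsInducing Φ := ⟨rfl⟩
  have hgrp : IsTopologicalGroup A := topologicalGroup_induced Φ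
  have : T2Space (Multiplicative (X → UnitAddCircle)) :=
    inferInstanceAs (T2Space (X → UnitAddCircle))
  have hT2 : T2Space A := T2Space.of_injective_continuous hΦ hind.continuous
  have hclosed : IsClosed S := hS t hgrp hT2
  have hone : Tendsto (fun m => s (φ m) / x) atTop (𝓝 1) := by
    rw [hind.tendsto_nhds_iff, map_one]
    exact tendsto_pi_nhds.mpr fun χ => χ.2
  have hlim : Tendsto (fun m => s (φ m)) atTop (𝓝 x) := by
    simpa using hone.mul_const x
  exact hclosed.mem_of_tendsto hlim (Eventually.of_forall fun m => hsS _)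

/-- In an abelian group the unconditionally closed sets are algebraic. -/
theorem IsUnconditionallyClosed.isAlgebraicSet {S : Set A} (hS : IsUnconditionallyClosed S) :
    IsAlgebraicSet S :=
  isAlgebraicSet_of_forall_isPowerAdherent fun _ => hS.mem_of_isPowerAdherent

end Abelian

/-! ### Zariski and Markov closed sets under passage to a subgroup -/

section Embedding

variable {G : Type*} [Group G]

theorem IsElementaryAlgebraic.isUnconditionallyClosed {S : Set G} (hS : IsElementaryAlgebraic S) :
    IsUnconditionallyClosed S := by
  obtain ⟨m, a, ε, -, rfl⟩ := hS
  intro t _ _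
  refine isClosed_eq (Continuous.mul ?_ (continuous_id.zpow _)) continuous_const
  simp only [List.ofFn_eq_map]
  exact continuous_list_prod _ fun i _ => (continuous_id.zpow _).mul continuous_const

theorem IsAlgebraicSet.isUnconditionallyClosed {S : Set G} (hS : IsAlgebraicSet S) :
    IsUnconditionallyClosed S := by
  obtain ⟨F, hF, rfl⟩ := hS
  intro t _ _
  refine isClosed_sInter fun B hB => ?_
  obtain ⟨E, hE, hEA, rfl⟩ := hF B hB
  rw [Set.sUnion_eq_biUnion]
  exact hE.isClosed_biUnion fun C hC => (hEA C hC).isUnconditionallyClosed t ‹_› ‹_›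

theorem isClosed_zariskiTopology_iff {S : Set G} :
    IsClosed[zariskiTopology G] S ↔ IsAlgebraicSet S :=
  (@isOpen_compl_iff G S (zariskiTopology G)).symm.trans (iff_of_eq (congrArg IsAlgebraicSet (compl_compl S)))

theorem isClosed_markovTopology_iff {S : Set G} :
    IsClosed[markovTopology G] S ↔ IsUnconditionallyClosed S :=
  (@isOpen_compl_iff G S (markovTopology G)).symm.trans (iff_of_eq (congrArg IsUnconditionallyClosed (compl_compl S)))

theorem IsElementaryAlgebraic.isAlgebraicSet {S : Set G} (hS : IsElementaryAlgebraic S) :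
    IsAlgebraicSet S :=
  ⟨{S}, fun _ hB => ⟨{S}, Set.finite_singleton S, fun _ hC => hC ▸ hS, by simpa using hB⟩,
    by simp⟩

/-- The same equation, with its coefficients read in `G`, defines `T`. -/
theorem IsElementaryAlgebraic.exists_preimage_coe_eq {H : Subgroup G} {S : Set H}
    (hS : IsElementaryAlgebraic S) :
    ∃ T : Set G, IsElementaryAlgebraic T ∧ ((↑) : H → G) ⁻¹' T = S := by
  obtain ⟨m, a, ε, hε, rfl⟩ := hS
  refine ⟨_, ⟨m, fun i => a i, ε, hε, rfl⟩, ?_⟩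
  ext x
  simp [Subtype.ext_iff, List.ofFn_eq_map, Function.comp_def]

/-- Every Zariski closed set of a subgroup is a trace of a Zariski closed set of the group. -/
theorem IsAlgebraicSet.isClosed_induced {H : Subgroup G} {S : Set H} (hS : IsAlgebraicSet S) :
    IsClosed[(zariskiTopology G).induced ((↑) : H → G)] S := by
  obtain ⟨F, hF, rfl⟩ := hS
  let := (zariskiTopology G).induced ((↑) : H → G)
  refine isClosed_sInter fun B hB => ?_
  obtain ⟨E, hE, hEA, rfl⟩ := hF B hB
  rw [Set.sUnion_eq_biUnion]
  refine hE.isClosed_biUnion fun C hC => ?_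
  obtain ⟨T, hT, hTC⟩ := (hEA C hC).exists_preimage_coe_eq
  exact (isClosed_induced_iff (t := zariskiTopology G)).mpr ⟨T, isClosed_zariskiTopology_iff.mpr hT.isAlgebraicSet, hTC⟩

end Embedding

end MarkovZariski

theorem corollary4p5 {G : Type*} [Group G] (H : Subgroup G)
    (hab : ∀ x ∈ H, ∀ y ∈ H, x * y = y * x)
    (hM : MarkovZariski.IsMarkovEmbedded H) :
    MarkovZariski.IsZariskiEmbedded H := by
  open MarkovZariski in
  refine TopologicalSpace.ext_isClosed fun S => ⟨fun hS => ?_, fun hS => ?_⟩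
  · exact (isClosed_zariskiTopology_iff.mp hS).isClosed_induced
  · obtain ⟨T, hT, rfl⟩ := (isClosed_induced_iff (t := zariskiTopology G)).mp hS
    have hTM : IsClosed[(markovTopology G).induced ((↑) : H → G)] (((↑) : H → G) ⁻¹' T) :=
      (isClosed_induced_iff (t := markovTopology G)).mpr ⟨T, isClosed_markovTopology_iff.mpr
        (isClosed_zariskiTopology_iff.mp hT).isUnconditionallyClosed, rfl⟩
    rw [← hM, isClosed_markovTopology_iff] at hTM
    let : CommGroup H :=
      { (inferInstance : Group H) with
        mul_comm := fun x y => Subtype.ext (hab x x.2 y y.2) }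
    exact isClosed_zariskiTopology_iff.mpr (IsUnconditionallyClosed.isAlgebraicSet hTM)
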